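/- Let $\beta>2$, $\kappa>0$, $r_0>0$, $\bar Q>0$ and $\bar R\in\mathbb R$, and let $C(x)=\log_2(1+x)$. A tagged receiver sits at a point $y$ of the plane and its transmitter at distance $r_0$ from it. For every bandwidth $B>0$ the interferers form a homogeneous Poisson process of intensity $\lambda_B=\kappa B$ in the plane, listed as $T_1,T_2,\dots$ in order of increasing distance to $y$. All transmitters have power $\bar Q/B$ per Hz, the path loss is $l(r)=r^{-\beta}$, the noise power per Hz is $1$, and every user has rate $R=\bar R/B$ per Hz. Thus the received powers per Hz are $P_0=l(r_0)\bar Q/B$ from the tagged transmitter and $I_j=l(|T_j-y|)\bar Q/B$ from the $j$-th interferer; we put $I_0=P_0$, $\bar P_0=l(r_0)\bar Q$ and $\rho=\kappa\pi r_0^2$. The optimal-decoder (OPT) condition at bandwidth $B$ is: $\sum_j I_j<\infty$ and $R<R_{\rm sym}$. Here $R_{\rm sym}$ is the supremum of all $R'$ for which there is a finite set $S\ni 0$ of transmitters with $$|T|\,R'\le C\Big(\frac{\sum_{j\in T}I_j}{1+\sum_{j\notin S}I_j}\Big)\quad\text{for every }T\subseteq S ,$$ or equivalently $$R_{\rm sym}=\max_{k\ge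 0}\ \min_{0\le l\le k}\ \frac1{l+1}\,C\Big(\frac{P_0+\sum_{i=k-l+1}^{k}I_i}{1+\sum_{i>k}I_i}\Big);$$ the inequality $R<R_{\rm sym}$ is claimed for both expressions. Theorem. Suppose that $$\rho\bar R<C\Big(\frac{\rho\bar P_0}{1+2\rho\bar P_0/(\beta-2)}\Big).$$ Then the OPT condition holds almost surely as $B\to\infty$, in the following sense. (a) Whatever the joint law of the interferer processes for different $B$, almost surely the OPT condition holds at all sufficiently large integer bandwidths $B$. (b) If, almost surely, the interferers at bandwidth $B$ are among those at bandwidth $B'$ whenever $0<B\le B'$ (users are added as the bandwidth grows), then almost surely there is a $B_0$ such that the OPT condition holds for all real $B\ge B_0$. -/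

import Mathlib

open MeasureTheory ProbabilityTheory Filter
open scoped NNReal

noncomputable section

namespace WidebandNetwork

/-- The Euclidean plane. -/
abbrev Plane : Type := EuclideanSpace ℝ (Fin 2)

/-! ### Poisson processes in the plane -/

/-- Number of points of the configuration `x 0, x 1, …` that lie in `A`, counted with
multiplicity; a priori it may be infinite. -/
def count (x : ℕ → Plane) (A : Set Plane) : ℕ∞ := {n : ℕ | x n ∈ A}.encard

/-- The random points `X · 0, X · 1, …` form a homogeneous Poisson process of intensity `lam`:
the number of points in a bounded Borel set `A` is Poisson distributed with mean
`lam` times the area of `A`, and the numbers of points in finitely many pairwise disjoint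
bounded Borel sets are independent. -/
structure IsPoissonProcess {Ω : Type*} [MeasurableSpace Ω] (μ : Measure Ω)
    (X : Ω → ℕ → Plane) (lam : ℝ≥0) : Prop where
  measurable : ∀ n, Measurable fun ω => X ω n
  law : ∀ A : Set Plane, MeasurableSet A → Bornology.IsBounded A →
    HasLaw (fun ω => count (X ω) A)
      ((poissonMeasure (lam * (volume A).toNNReal)).map (fun n : ℕ => (n : ℕ∞))) μ
  indep : ∀ (m : ℕ) (A : Fin m → Set Plane), (∀ i, MeasurableSet (A i)) →
    (∀ i, Bornology.IsBounded (A i)) → Pairwise (fun i j => Disjoint (A i) (A j)) →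
    iIndepFun (fun i ω => count (X ω) (A i)) μ

/-- Every point of the configuration `x` is also a point of the configuration `x'`
(with multiplicity). -/
def IsSubconfiguration (x x' : ℕ → Plane) : Prop :=
  ∃ g : ℕ → ℕ, Function.Injective g ∧ ∀ n, x n = x' (g n)

/-! ### The optimal decoder

In this part `P : ℕ → ℝ` lists received powers per Hz at the tagged receiver: `P 0` comes from
the tagged transmitter and `P j`, `j ≥ 1`, from the `j`-th interferer. The noise power is `1`
and logarithms are to base `2`. -/

/-- `C(x) = log₂ (1 + x)`. -/
def C (x : ℝ) : ℝ := Real.logb 2 (1 + x)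

/-- The capacity region of the Gaussian multiple access channel from the transmitters in `S`
to the tagged receiver, all other signals being treated as noise. -/
def macRegion (P : ℕ → ℝ) (S : Finset ℕ) : Set (ℕ → ℝ) :=
  {R | ∀ T ⊆ S, ∑ l ∈ T, R l ≤ C ((∑ l ∈ T, P l) / (1 + ∑' l : {l : ℕ // l ∉ S}, P l))}

/-- The rate region of the tagged receiver: the rate tuples that lie in the multiple access
region of some set of transmitters containing the tagged one. -/
def taggedRegion (P : ℕ → ℝ) : Set (ℕ → ℝ) :=
  {R | ∃ S : Finset ℕ, 0 ∈ S ∧ R ∈ macRegion P S}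

/-- The symmetric rate: the supremum of all `R` with `(R, R, …)` in the rate region of the
tagged receiver. -/
def symmetricRate (P : ℕ → ℝ) : ℝ :=
  sSup {R : ℝ | (fun _ : ℕ => R) ∈ taggedRegion P}

/-- `ξ(k)`, the largest common rate for joint decoding of the tagged message and the messages
of the first `k` interferers:
`min_{0 ≤ l ≤ k} (l + 1)⁻¹ C ((P₀ + I[k-l+1 : k]) / (1 + I[k+1 : ∞]))`. -/
def jointDecodingRate (P : ℕ → ℝ) (k : ℕ) : ℝ :=
  (Finset.range (k + 1)).inf' Finset.nonempty_range_add_one fun l =>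
    1 / ((l : ℝ) + 1) *
      C ((P 0 + ∑ i ∈ Finset.Icc (k - l + 1) k, P i) / (1 + ∑' i : ℕ, P (k + 1 + i)))

/-- The symmetric rate in its max-min form `max_{k ≥ 0} ξ(k)`; the interferers are understood to
be listed in decreasing order of received power. -/
def maxMinRate (P : ℕ → ℝ) : ℝ := ⨆ k : ℕ, jointDecodingRate P k

/-- The condition for optimal decoding at rate `R`: the total interference is finite and `R` is
smaller than the symmetric rate, in either of its two forms. -/
def OptCondition (P : ℕ → ℝ) (R : ℝ) : Prop :=
  Summable P ∧ R < symmetricRate P ∧ R < maxMinRate P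

/-! ### Received powers -/

/-- The path loss `r ^ (-β)` at distance `r > 0`. -/
def pathLoss (β r : ℝ) : ℝ := r ^ (-β)

/-- Received powers at a receiver located at `y`, when all transmitters have power `Q`, the
tagged transmitter is at distance `r₀` from `y` and the interferers are at `x 0, x 1, …`. -/
def receivedPower (β Q r₀ : ℝ) (y : Plane) (x : ℕ → Plane) : ℕ → ℝ
  | 0 => pathLoss β r₀ * Q
  | n + 1 => pathLoss β (dist (x n) y) * Q

end WidebandNetwork

end

namespace WidebandNetwork

/-! ### Poisson tail bounds -/

/-! Decode jointly the tagged signal and all interferers within `r₀` of `y`, and treat the rest as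
noise. The disc holds about `ρB` interferers, each received at least as strongly as the tagged
signal, so the decoded signals have total power at least about `ρP̄₀` and total rate about `ρR̄`.
The outside interference is close to its mean `∫_{r₀}^∞ 2πκB r · r^(-β) Q̄/B dr = 2ρP̄₀/(β-2)`. The
hypothesis is thus the constraint for the full decoded set; the constraints for its subsets follow
because `C` is concave with `C 0 = 0` (`optCondition_of_forall_le`).

The randomness enters only through `IsRegular`, a bound on disc counts. Chernoff bounds on a grid of
radii are summable over radii and integer bandwidths, so Borel–Cantelli gives regularity eventually,
whatever the joint law (`ae_eventually_isRegular`). The rest is deterministic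
(`IsRegular.optCondition`). For nested networks, a real bandwidth is squeezed between consecutive
integers (`IsRegular.of_between`). -/

theorem hasSum_poisson_exp (r : ℝ≥0) (t : ℝ) :
    HasSum (fun n : ℕ => Real.exp (-r) * r ^ n / n.factorial * Real.exp (t * n))
      (Real.exp (r * (Real.exp t - 1))) := by
  have h := (NormedSpace.expSeries_div_hasSum_exp (r * Real.exp t : ℝ)).mul_left
    (Real.exp (-(r : ℝ)))
  rw [← Real.exp_eq_exp_ℝ, ← Real.exp_add] at h
  convert! h using 1
  · funext n
    rw [mul_pow, ← Real.exp_nat_mul, mul_comm t]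
    ring
  · congr 1; ring

theorem integrable_exp_poissonMeasure (r : ℝ≥0) (t : ℝ) :
    Integrable (fun n : ℕ => Real.exp (t * n)) (poissonMeasure r) := by
  rw [integrable_poissonMeasure_iff]
  simpa only [Real.norm_eq_abs, Real.abs_exp] using (hasSum_poisson_exp r t).summable

theorem mgf_poissonMeasure (r : ℝ≥0) (t : ℝ) :
    mgf (fun n : ℕ => (n : ℝ)) (poissonMeasure r) t = Real.exp (r * (Real.exp t - 1)) := by
  rw [mgf, integral_poissonMeasure]
  simpa only [smul_eq_mul] using (hasSum_poisson_exp r t).tsum_eq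

/-- Chernoff bound for both tails of the Poisson distribution. -/
theorem poissonMeasure_deviation_le (r : ℝ≥0) {ε : ℝ} (hε : 0 ≤ ε) (hε1 : ε ≤ 1) :
    poissonMeasure r {n : ℕ | ¬ ((1 - ε) * r ≤ n ∧ (n : ℝ) ≤ (1 + ε) * r)} ≤
      ENNReal.ofReal (2 * Real.exp (-(ε ^ 2 / 4) * r)) := by
  have hexp : ∀ t : ℝ, |t| ≤ 1 → Real.exp t - 1 ≤ t + t ^ 2 := fun t ht => by
    have := (abs_le.1 (Real.abs_exp_sub_one_sub_id_le ht)).2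
    linarith
  have hr : (0 : ℝ) ≤ r := r.2
  have hup : (poissonMeasure r).real {n : ℕ | (1 + ε) * (r : ℝ) ≤ n} ≤
      Real.exp (-(ε ^ 2 / 4) * r) := by
    -- By `exp t - 1 ≤ t + t ^ 2` the exponent is at most `(t ^ 2 - ε * t) * r`, which is least at
    -- `t = ε / 2`.
    refine (measure_ge_le_exp_mul_mgf (X := fun n : ℕ => (n : ℝ)) _ (by positivity : 0 ≤ ε / 2)
      (integrable_exp_poissonMeasure r _)).trans ?_
    rw [mgf_poissonMeasure, ← Real.exp_add]
    have := mul_le_mul_of_nonneg_left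
      (hexp (ε / 2) (by rw [abs_of_nonneg (by positivity)]; linarith)) hr
    apply Real.exp_le_exp.2
    nlinarith
  have hlow : (poissonMeasure r).real {n : ℕ | (n : ℝ) ≤ (1 - ε) * (r : ℝ)} ≤
      Real.exp (-(ε ^ 2 / 4) * r) := by
    refine (measure_le_le_exp_mul_mgf (X := fun n : ℕ => (n : ℝ)) _
      (by linarith : -(ε / 2) ≤ 0) (integrable_exp_poissonMeasure r _)).trans ?_
    rw [mgf_poissonMeasure, ← Real.exp_add]
    have := mul_le_mul_of_nonneg_left
      (hexp (-(ε / 2)) (by rw [abs_neg, abs_of_nonneg (by positivity)]; linarith)) hr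
    apply Real.exp_le_exp.2
    nlinarith
  rw [← ofReal_measureReal]
  apply ENNReal.ofReal_le_ofReal
  refine (measureReal_mono (s₂ := {n : ℕ | (1 + ε) * (r : ℝ) ≤ n} ∪
    {n : ℕ | (n : ℝ) ≤ (1 - ε) * (r : ℝ)}) ?_).trans ((measureReal_union_le _ _).trans ?_)
  · intro n hn
    by_contra h
    simp only [Set.mem_union, Set.mem_ofPred_eq, not_or, not_le] at h
    exact hn ⟨h.2.le, h.1.le⟩
  · linarith

/-! ### Counts in discs -/

variable {Ω : Type*} [MeasurableSpace Ω] {μ : Measure Ω} {X : Ω → ℕ → Plane} {lam : ℝ≥0}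

theorem toNNReal_volume_closedBall (y : Plane) {r : ℝ} (hr : 0 ≤ r) :
    (((volume (Metric.closedBall y r)).toNNReal : ℝ≥0) : ℝ) = Real.pi * r ^ 2 := by
  rw [EuclideanSpace.volume_closedBall_fin_two, ENNReal.coe_toNNReal_eq_toReal, ENNReal.toReal_mul,
    ENNReal.toReal_pow, ENNReal.toReal_ofReal hr, ENNReal.toReal_ofReal Real.pi_pos.le]
  ring

/-- The event is phrased so as to include an infinite count, which has probability zero since the
law is carried by the finite values. -/
theorem measure_count_notMem_le (hX : IsPoissonProcess μ X lam) {A : Set Plane}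
    (hA : MeasurableSet A) (hA' : Bornology.IsBounded A) (s : Set ℕ) :
    μ {ω | ∀ k ∈ s, count (X ω) A ≠ k} = poissonMeasure (lam * (volume A).toNNReal) sᶜ := by
  rw [(hX.law A hA hA').measure_eq (p := fun c : ℕ∞ => ∀ k ∈ s, c ≠ k)
    (MeasurableSet.of_discrete), Measure.map_apply .of_discrete .of_discrete]
  congr 1
  ext n
  simp only [Set.mem_preimage, Set.mem_ofPred_eq, Set.mem_compl_iff, ne_eq, Nat.cast_inj]
  exact ⟨fun h hn => h n hn rfl, fun h k hk hnk => h (hnk ▸ hk)⟩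

/-- The number of points in the disc of radius `r` around `y` is within a factor `1 ± ε`
of `a * r ^ 2`. -/
def CountNear (x : ℕ → Plane) (y : Plane) (a ε r : ℝ) : Prop :=
  ∃ k : ℕ, count x (Metric.closedBall y r) = k ∧ (1 - ε) * (a * r ^ 2) ≤ k ∧
    (k : ℝ) ≤ (1 + ε) * (a * r ^ 2)

theorem measure_not_countNear_le (hX : IsPoissonProcess μ X lam) (y : Plane) {r : ℝ}
    (hr : 0 ≤ r) {ε : ℝ} (hε : 0 ≤ ε) (hε1 : ε ≤ 1) :
    μ {ω | ¬ CountNear (X ω) y (lam * Real.pi) ε r} ≤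
      ENNReal.ofReal (2 * Real.exp (-(ε ^ 2 / 4) * (lam * Real.pi * r ^ 2))) := by
  have hm : ((lam * (volume (Metric.closedBall y r)).toNNReal : ℝ≥0) : ℝ) =
      lam * Real.pi * r ^ 2 := by
    rw [NNReal.coe_mul, toNNReal_volume_closedBall y hr]; ring
  have h1 := measure_count_notMem_le hX (Metric.isClosed_closedBall (x := y) (ε := r)).measurableSet
    Metric.isBounded_closedBall
    {k : ℕ | (1 - ε) * (lam * Real.pi * r ^ 2) ≤ k ∧ (k : ℝ) ≤ (1 + ε) * (lam * Real.pi * r ^ 2)}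
  have h2 := poissonMeasure_deviation_le
    (lam * (volume (Metric.closedBall y r)).toNNReal) hε hε1
  rw [hm] at h2
  refine le_of_eq_of_le ?_ (h1.le.trans h2)
  congr 1
  ext ω
  simp only [CountNear, Set.mem_ofPred_eq, not_exists, not_and]
  exact ⟨fun h k hk hc => h k hc hk.1 hk.2, fun h k hc h1 h2 => h k ⟨h1, h2⟩ hc⟩

/-- A singleton has area zero. A point at `y` would do harm: `0 ^ (-β) = 0` in Lean, so it would
count as a signal of power zero inside the disc. -/
theorem ae_forall_ne (hX : IsPoissonProcess μ X lam) (y : Plane) :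
    ∀ᵐ ω ∂μ, ∀ n, X ω n ≠ y := by
  have h1 := measure_count_notMem_le hX (measurableSet_singleton y) Bornology.isBounded_singleton
    {0}
  have h2 : poissonMeasure (lam * (volume ({y} : Set Plane)).toNNReal) {0}ᶜ = 0 := by
    rw [prob_compl_eq_zero_iff (measurableSet_singleton 0), poissonMeasure_singleton]
    simp
  rw [h2] at h1
  have h3 : ∀ᵐ ω ∂μ, ¬ ∀ k ∈ ({0} : Set ℕ), count (X ω) {y} ≠ k := by
    rw [ae_iff]; simpa only [not_not] using h1
  filter_upwards [h3] with ω hω n hn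
  simp only [Set.mem_singleton_iff, forall_eq, Nat.cast_zero, ne_eq, not_not, count,
    Set.encard_eq_zero] at hω
  exact Set.notMem_empty n (hω ▸ hn)

/-! ### Regular configurations -/

/-- No point is at `y`, the discs around `y` of radius at least `r₀` do not contain too many
points, and the one of radius `r₀` contains enough of them. -/
structure IsRegular (x : ℕ → Plane) (y : Plane) (r₀ a ε : ℝ) : Prop where
  ne : ∀ n, x n ≠ y
  count_le : ∀ r, r₀ ≤ r → ∃ k : ℕ, count x (Metric.closedBall y r) = k ∧
    (k : ℝ) ≤ (1 + ε) * (a * r ^ 2)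
  le_count : ∃ k : ℕ, count x (Metric.closedBall y r₀) = k ∧ (1 - ε) * (a * r₀ ^ 2) ≤ k

theorem count_mono (x : ℕ → Plane) {A A' : Set Plane} (h : A ⊆ A') : count x A ≤ count x A' :=
  Set.encard_le_encard fun _ hn => h hn

theorem IsSubconfiguration.count_le {x x' : ℕ → Plane} (h : IsSubconfiguration x x')
    (A : Set Plane) : count x A ≤ count x' A := by
  obtain ⟨g, hg, hx⟩ := h
  rw [count, count, ← hg.encard_image]
  apply Set.encard_le_encard
  rintro _ ⟨n, hn, rfl⟩
  change x' (g n) ∈ A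
  rw [← hx n]
  exact hn

theorem exists_nat_of_le {c : ℕ∞} {k : ℕ} (h : c ≤ k) : ∃ m : ℕ, c = m ∧ m ≤ k := by
  lift c to ℕ using ne_top_of_le_ne_top (ENat.natCast_ne_top k) h
  exact ⟨c, rfl, by exact_mod_cast h⟩

/-- The squares of the radii run through an arithmetic progression. -/
theorem isRegular_of_grid {x : ℕ → Plane} {y : Plane} {r₀ a ε : ℝ} (hr₀ : 0 < r₀) (ha : 0 ≤ a)
    (hε : 0 < ε) (hε1 : ε ≤ 1) (hne : ∀ n, x n ≠ y)
    (h : ∀ j : ℕ, CountNear x y a ε (r₀ * √(1 + j * ε))) : IsRegular x y r₀ a (3 * ε) where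
  ne := hne
  count_le r hr := by
    have hq : 1 ≤ (r / r₀) ^ 2 := one_le_pow₀ ((one_le_div hr₀).2 hr)
    -- The first grid radius that is at least `r`; its square overshoots `r ^ 2` by at most `ε * r₀
    -- ^ 2 ≤ ε * r ^ 2`.
    set j := ⌈((r / r₀) ^ 2 - 1) / ε⌉₊ with hj
    have hj1 : (r / r₀) ^ 2 ≤ 1 + j * ε := by
      have := (div_le_iff₀ hε).1 (Nat.le_ceil (((r / r₀) ^ 2 - 1) / ε))
      linarith
    have hj2 : 1 + j * ε ≤ (1 + ε) * (r / r₀) ^ 2 := by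
      have h0 : (j : ℝ) < ((r / r₀) ^ 2 - 1) / ε + 1 :=
        Nat.ceil_lt_add_one (div_nonneg (by linarith) hε.le)
      have := mul_lt_mul_of_pos_right h0 hε
      rw [add_mul, div_mul_cancel₀ _ hε.ne'] at this
      nlinarith
    have hr' : r ≤ r₀ * √(1 + j * ε) := by
      rw [← div_le_iff₀' hr₀]
      exact Real.le_sqrt_of_sq_le hj1
    obtain ⟨k, hk, -, hk2⟩ := h j
    obtain ⟨m, hm, hmk⟩ := exists_nat_of_le
      ((count_mono x (Metric.closedBall_subset_closedBall hr')).trans hk.le)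
    refine ⟨m, hm, (Nat.cast_le.2 hmk).trans (hk2.trans ?_)⟩
    rw [mul_pow, Real.sq_sqrt (by positivity)]
    have hrr : r ^ 2 = r₀ ^ 2 * (r / r₀) ^ 2 := by field_simp
    calc (1 + ε) * (a * (r₀ ^ 2 * (1 + j * ε)))
        ≤ (1 + ε) * (a * (r₀ ^ 2 * ((1 + ε) * (r / r₀) ^ 2))) := by gcongr
      _ = (1 + ε) * (1 + ε) * (a * r ^ 2) := by rw [hrr]; ring
      _ ≤ (1 + 3 * ε) * (a * r ^ 2) := by
        apply mul_le_mul_of_nonneg_right _ (by positivity)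
        nlinarith
  le_count := by
    obtain ⟨k, hk, hk1, -⟩ := h 0
    simp only [Nat.cast_zero, zero_mul, add_zero, Real.sqrt_one, mul_one] at hk hk1
    refine ⟨k, hk, le_trans ?_ hk1⟩
    apply mul_le_mul_of_nonneg_right _ (by positivity)
    linarith

/-- Upper bounds on counts pass down from `x₂` and lower bounds pass up from `x₁`; the change of
intensity is absorbed by enlarging `ε` to `ε'`. -/
theorem IsRegular.of_between {x x₁ x₂ : ℕ → Plane} {y : Plane} {r₀ a a₁ a₂ ε ε' : ℝ}
    (h₁ : IsRegular x₁ y r₀ a₁ ε) (h₂ : IsRegular x₂ y r₀ a₂ ε) (hx₁ : IsSubconfiguration x₁ x)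
    (hx₂ : IsSubconfiguration x x₂) (ha₁ : (1 - ε') * a ≤ (1 - ε) * a₁)
    (ha₂ : (1 + ε) * a₂ ≤ (1 + ε') * a) : IsRegular x y r₀ a ε' where
  ne n := by
    obtain ⟨g, -, hg⟩ := hx₂
    exact hg n ▸ h₂.ne (g n)
  count_le r hr := by
    obtain ⟨k, hk, hk'⟩ := h₂.count_le r hr
    obtain ⟨m, hm, hmk⟩ := exists_nat_of_le ((hx₂.count_le _).trans hk.le)
    refine ⟨m, hm, (Nat.cast_le.2 hmk).trans (hk'.trans ?_)⟩
    have := mul_le_mul_of_nonneg_right ha₂ (sq_nonneg r)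
    linarith
  le_count := by
    obtain ⟨k, hk, -⟩ := h₂.count_le r₀ le_rfl
    obtain ⟨m, hm, -⟩ := exists_nat_of_le ((hx₂.count_le _).trans hk.le)
    obtain ⟨k', hk', hk1⟩ := h₁.le_count
    have hkm : k' ≤ m := by
      have := hx₁.count_le (Metric.closedBall y r₀)
      rw [hm, hk'] at this
      exact_mod_cast this
    refine ⟨m, hm, le_trans ?_ (Nat.cast_le.2 hkm)⟩
    have := mul_le_mul_of_nonneg_right ha₁ (sq_nonneg r₀)
    linarith

/-- Poisson configurations whose intensities grow linearly are eventually regular. -/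
theorem ae_eventually_isRegular {X : ℕ → Ω → ℕ → Plane} {lam : ℕ → ℝ≥0} {κ : ℝ} (hκ : 0 < κ)
    (hlam : ∀ n, (lam n : ℝ) = κ * n) (hX : ∀ n, 0 < n → IsPoissonProcess μ (X n) (lam n))
    (y : Plane) {r₀ : ℝ} (hr₀ : 0 < r₀) {ε : ℝ} (hε : 0 < ε) (hε1 : ε ≤ 1) :
    ∀ᵐ ω ∂μ, ∀ᶠ n : ℕ in atTop, IsRegular (X n ω) y r₀ (κ * n * Real.pi) (3 * ε) := by
  set c : ℝ := ε ^ 2 / 4 * (κ * Real.pi * r₀ ^ 2) with hc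
  have hc0 : 0 < c := by positivity
  let bad : ℕ → ℕ → Set Ω := fun n j =>
    {ω | ¬ CountNear (X (n + 1) ω) y (lam (n + 1) * Real.pi) ε (r₀ * √(1 + j * ε))}
  have hbad : ∀ n j, μ (bad n j) ≤
      ENNReal.ofReal (2 * (Real.exp (-c) ^ n * Real.exp (-(c * ε)) ^ j)) := by
    intro n j
    refine (measure_not_countNear_le (hX (n + 1) n.succ_pos) y (by positivity) hε.le hε1).trans ?_
    apply ENNReal.ofReal_le_ofReal
    rw [← Real.exp_nat_mul, ← Real.exp_nat_mul, ← Real.exp_add, mul_pow,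
      Real.sq_sqrt (by positivity), hlam]
    apply mul_le_mul_of_nonneg_left _ zero_le_two
    apply Real.exp_le_exp.2
    have h1 : -(ε ^ 2 / 4) * (κ * ((n + 1 : ℕ) : ℝ) * Real.pi * (r₀ ^ 2 * (1 + j * ε))) =
        -(c * ((n + 1) * (1 + j * ε))) := by push_cast; rw [hc]; ring
    rw [h1]
    -- Dropping this cross term from `(n + 1) * (1 + j * ε)` leaves a product of two geometric
    -- sequences, summable in `n` and `j`.
    have h2 : 0 ≤ c * (n * (j * ε)) := by positivity
    linarith
  have hsum : ∑' n, μ (⋃ j, bad n j) ≠ ⊤ := by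
    have hs1 : Summable fun n : ℕ => Real.exp (-c) ^ n :=
      summable_geometric_of_lt_one (Real.exp_pos _).le (Real.exp_lt_one_iff.2 (by linarith))
    have hs2 : Summable fun n : ℕ => Real.exp (-(c * ε)) ^ n :=
      summable_geometric_of_lt_one (Real.exp_pos _).le
        (Real.exp_lt_one_iff.2 (by have := mul_pos hc0 hε; linarith))
    have hle : ∀ n, μ (⋃ j, bad n j) ≤
        ENNReal.ofReal (Real.exp (-c) ^ n * (2 * ∑' j : ℕ, Real.exp (-(c * ε)) ^ j)) := by
      intro n
      refine (measure_iUnion_le _).trans ((ENNReal.tsum_le_tsum (hbad n)).trans ?_)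
      rw [← ENNReal.ofReal_tsum_of_nonneg (fun j => by positivity)
        ((hs2.mul_left _).mul_left _), tsum_mul_left, tsum_mul_left]
      apply ENNReal.ofReal_le_ofReal
      apply le_of_eq; ring
    refine ne_top_of_le_ne_top ?_ (ENNReal.tsum_le_tsum hle)
    exact (hs1.mul_right _).tsum_ofReal_ne_top
  have hne : ∀ᵐ ω ∂μ, ∀ n, ∀ m, X (n + 1) ω m ≠ y :=
    ae_all_iff.2 fun n => ae_forall_ne (hX (n + 1) n.succ_pos) y
  filter_upwards [hne, ae_eventually_notMem hsum] with ω hω hω'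
  rw [← map_add_atTop_eq_nat 1, eventually_map]
  filter_upwards [hω'] with n hn
  refine isRegular_of_grid hr₀ (by positivity) hε hε1 (hω n) fun j => ?_
  rw [← hlam]
  by_contra h
  exact hn (Set.mem_iUnion.2 ⟨j, h⟩)


/-! ### Rates -/

theorem C_mono {u v : ℝ} (hu : 0 ≤ u) (huv : u ≤ v) : C u ≤ C v :=
  Real.logb_le_logb_of_le one_lt_two (by linarith) (by linarith)

/-- Concavity of the logarithm along the chord from `0`, where `C` vanishes. -/
theorem mul_C_le_C_mul {t u : ℝ} (ht : 0 ≤ t) (ht1 : t ≤ 1) (hu : 0 ≤ u) :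
    t * C u ≤ C (t * u) := by
  have h := strictConcaveOn_log_Ioi.concaveOn.2 (Set.mem_Ioi.2 (by linarith : 0 < 1 + u))
    (Set.mem_Ioi.2 one_pos) ht (sub_nonneg.2 ht1) (by ring)
  simp only [smul_eq_mul, Real.log_one, mul_zero, add_zero, mul_one] at h
  rw [C, C, Real.logb, Real.logb, ← mul_div_assoc]
  apply div_le_div_of_nonneg_right _ (Real.log_pos one_lt_two).le
  convert h using 2
  ring

theorem continuousAt_C {u : ℝ} (hu : 0 ≤ u) : ContinuousAt C u := by
  unfold C Real.logb
  exact ((continuousAt_const.add continuousAt_id).log (by simp; linarith)).div_const _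

section

variable {P : ℕ → ℝ}

/-- The constraint for the tagged transmitter alone, without interference. It makes the set of rates
bounded above, as a real supremum requires. -/
theorem le_C_of_mem_taggedRegion (hP0 : ∀ i, 0 ≤ P i) {R : ℝ}
    (hR : (fun _ : ℕ => R) ∈ taggedRegion P) : R ≤ C (P 0) := by
  obtain ⟨S, h0, hS⟩ := hR
  have h := hS {0} (Finset.singleton_subset_iff.2 h0)
  rw [Finset.sum_singleton, Finset.sum_singleton] at h
  have hJ : 0 ≤ ∑' l : {l : ℕ // l ∉ S}, P l := tsum_nonneg fun l => hP0 l
  exact h.trans (C_mono (div_nonneg (hP0 0) (by linarith))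
    (div_le_self (hP0 0) (by linarith)))

theorem jointDecodingRate_le_C (hP0 : ∀ i, 0 ≤ P i) (k : ℕ) : jointDecodingRate P k ≤ C (P 0) := by
  refine (Finset.inf'_le _ (Finset.mem_range.2 k.succ_pos)).trans ?_
  have hJ : 0 ≤ ∑' i : ℕ, P (k + 1 + i) := tsum_nonneg fun i => hP0 _
  have hemp : Finset.Icc (k - 0 + 1) k = ∅ := Finset.Icc_eq_empty (by omega)
  rw [hemp, Finset.sum_empty, add_zero, Nat.cast_zero, zero_add, div_one, one_mul]
  exact C_mono (div_nonneg (hP0 0) (by linarith)) (div_le_self (hP0 0) (by linarith))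

theorem tsum_notMem_range (k : ℕ) :
    ∑' l : {l : ℕ // l ∉ Finset.range k}, P l = ∑' i : ℕ, P (k + i) := by
  let e : ℕ ≃ {l : ℕ // l ∉ Finset.range k} :=
    { toFun := fun i => ⟨k + i, by simp⟩
      invFun := fun l => l.1 - k
      left_inv := fun i => by simp
      right_inv := fun l => by
        have := l.2
        rw [Finset.mem_range, not_lt] at this
        exact Subtype.ext (Nat.add_sub_cancel' this) }
  exact (e.tsum_eq fun l : {l : ℕ // l ∉ Finset.range k} => P l).symm

/-- Jointly decoding all the signals of power at least `p` is possible at every rate that is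
possible for equally many signals of power exactly `p`. -/
theorem optCondition_of_forall_le (hP : Summable P) (hP0 : ∀ i, 0 ≤ P i) {k : ℕ} {p J R : ℝ}
    (hp : 0 ≤ p) (hle : ∀ i ≤ k, p ≤ P i) (hJ : ∑' i : ℕ, P (k + 1 + i) ≤ J)
    (hR : (k + 1) * R < C ((k + 1) * p / (1 + J))) : OptCondition P R := by
  have hk : (0 : ℝ) < k + 1 := by positivity
  have hJ' : 0 ≤ ∑' i : ℕ, P (k + 1 + i) := tsum_nonneg fun i => hP0 _
  set J' := ∑' i : ℕ, P (k + 1 + i)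
  set R' := C ((k + 1) * p / (1 + J)) / (k + 1) with hR'
  have hRR' : R < R' := by
    rw [hR', lt_div_iff₀ hk, mul_comm]; exact hR
  -- The single estimate behind both forms of the symmetric rate: `m` of the `k + 1` signals carry
  -- the fraction `m / (k + 1)` of the rate and at least that fraction of the power `(k + 1) * p`.
  have hrate : ∀ (m : ℕ) (s : ℝ), m ≤ k + 1 → m * p ≤ s → m * R' ≤ C (s / (1 + J')) := by
    intro m s hm hs
    have hm' : (m : ℝ) ≤ k + 1 := by exact_mod_cast hm
    calc m * R' = m / (k + 1) * C ((k + 1) * p / (1 + J)) := by rw [hR']; ring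
      _ ≤ C (m / (k + 1) * ((k + 1) * p / (1 + J))) :=
        mul_C_le_C_mul (by positivity) ((div_le_one hk).2 hm')
          (div_nonneg (by positivity) (by linarith))
      _ = C (m * p / (1 + J)) := by congr 1; field_simp
      _ ≤ C (s / (1 + J')) := by
        have h0 : 0 ≤ (m : ℝ) * p := by positivity
        apply C_mono (div_nonneg h0 (by linarith))
        exact div_le_div₀ (h0.trans hs) hs (by linarith) (by linarith)
  refine ⟨hP, hRR'.trans_le ?_, hRR'.trans_le ?_⟩
  · refine le_csSup ⟨C (P 0), fun R hR => le_C_of_mem_taggedRegion hP0 hR⟩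
      ⟨Finset.range (k + 1), by simp, fun T hT => ?_⟩
    rw [tsum_notMem_range, Finset.sum_const, nsmul_eq_mul]
    refine hrate _ _ (by simpa using Finset.card_le_card hT) ?_
    rw [← nsmul_eq_mul]
    refine Finset.card_nsmul_le_sum _ _ _ fun i hi => hle i ?_
    have := Finset.mem_range.1 (hT hi)
    omega
  · refine le_trans ?_ (le_ciSup (f := jointDecodingRate P) ⟨C (P 0), ?_⟩ k)
    · refine Finset.le_inf' _ _ fun l hl => ?_
      have hlk : l ≤ k := Nat.lt_succ_iff.1 (Finset.mem_range.1 hl)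
      rw [one_div, ← div_eq_inv_mul, le_div_iff₀ (by positivity), mul_comm]
      have h := hrate (l + 1) (P 0 + ∑ i ∈ Finset.Icc (k - l + 1) k, P i) (by omega) ?_
      · exact_mod_cast h
      · have h1 : (Finset.Icc (k - l + 1) k).card • p ≤ ∑ i ∈ Finset.Icc (k - l + 1) k, P i :=
          Finset.card_nsmul_le_sum _ _ _ fun i hi => hle i (Finset.mem_Icc.1 hi).2
        have hcard : (Finset.Icc (k - l + 1) k).card = l := by rw [Nat.card_Icc]; omega
        rw [hcard, nsmul_eq_mul] at h1
        have := hle 0 k.zero_le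
        push_cast
        linarith
    · rintro _ ⟨k, rfl⟩
      exact jointDecodingRate_le_C hP0 k

end

/-! ### Interference in regular configurations -/

/-- Comparison of the tail with the integral of `t ^ (-s)` over `(k, ∞)`. -/
theorem summable_and_tsum_rpow_neg_le {s : ℝ} (hs : 1 < s) {k : ℕ} (hk : 0 < k) :
    (Summable fun i : ℕ => ((k + i + 1 : ℕ) : ℝ) ^ (-s)) ∧
      ∑' i : ℕ, ((k + i + 1 : ℕ) : ℝ) ^ (-s) ≤ (k : ℝ) ^ (1 - s) / (s - 1) := by
  have hk' : (0 : ℝ) < k := by exact_mod_cast hk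
  constructor
  · have h := (Real.summable_nat_rpow (p := -s)).2 (by linarith)
    have h2 := (summable_nat_add_iff (k + 1)).2 h
    refine h2.congr fun i => ?_
    rw [show i + (k + 1) = k + i + 1 by ring]
  · have h := AntitoneOn.tsum_comp_add_le_integral (f := fun t : ℝ => t ^ (-s)) k
      (fun a ha b hb hab => Real.rpow_le_rpow_of_nonpos (hk'.trans_le ha) hab (by linarith))
      (integrableOn_Ioi_rpow_of_lt (by linarith) hk')
      (fun t ht => Real.rpow_nonneg (hk'.trans ht).le _)
    rw [integral_Ioi_rpow_of_lt (by linarith) hk'] at h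
    simp only [add_comm _ k] at h
    refine h.trans (le_of_eq ?_)
    rw [show -s + 1 = -(s - 1) by ring, neg_div_neg_eq, show 1 - s = -(s - 1) by ring]

section

variable {x : ℕ → Plane} {y : Plane} {r₀ a ε : ℝ}

theorem succ_le_count (hx : Monotone fun n => dist (x n) y) {n : ℕ} {r : ℝ}
    (hr : dist (x n) y ≤ r) : ((n + 1 : ℕ) : ℕ∞) ≤ count x (Metric.closedBall y r) := by
  have h : ((Finset.range (n + 1) : Finset ℕ) : Set ℕ) ⊆ {m | x m ∈ Metric.closedBall y r} := by
    intro m hm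
    rw [Finset.coe_range, Set.mem_Iio] at hm
    exact (hx (Nat.lt_succ_iff.1 hm)).trans hr
  have h2 := Set.encard_le_encard h
  rwa [Set.encard_coe_eq_coe_finsetCard, Finset.card_range] at h2

/-- Since the points are sorted, those in the disc form an initial segment of the indices. -/
theorem dist_le_iff_lt_count (hx : Monotone fun n => dist (x n) y) {k : ℕ} {r : ℝ}
    (hk : count x (Metric.closedBall y r) = k) (n : ℕ) : dist (x n) y ≤ r ↔ n < k := by
  refine ⟨fun h => ?_, fun h => ?_⟩
  · have := succ_le_count hx h
    rw [hk, Nat.cast_le] at this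
    exact this
  · by_contra! hn
    have hsub : {m | x m ∈ Metric.closedBall y r} ⊆ ((Finset.range n : Finset ℕ) : Set ℕ) := by
      intro m hm
      rw [Finset.coe_range, Set.mem_Iio]
      by_contra! hnm
      exact absurd ((hn.trans_le (hx hnm)).trans_le (Metric.mem_closedBall.1 hm)) (lt_irrefl _)
    have h2 := Set.encard_le_encard hsub
    rw [Set.encard_coe_eq_coe_finsetCard, Finset.card_range] at h2
    have h3 : (k : ℕ∞) ≤ n := hk ▸ h2
    exact absurd (Nat.cast_le.1 h3) (not_le.2 h)

/-- The disc reaching out to the `n`-th point contains at least `n + 1` points, so regularity bounds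
its radius from below. -/
theorem IsRegular.pathLoss_le (h : IsRegular x y r₀ a ε) (hx : Monotone fun n => dist (x n) y)
    (ha : 0 < (1 + ε) * a) {β : ℝ} (hβ : 0 ≤ β) {n : ℕ} (hn : r₀ ≤ dist (x n) y) :
    pathLoss β (dist (x n) y) ≤ ((1 + ε) * a) ^ (β / 2) * ((n + 1 : ℕ) : ℝ) ^ (-(β / 2)) := by
  obtain ⟨m, hm, hm'⟩ := h.count_le _ hn
  have hnm : n + 1 ≤ m := by
    have := succ_le_count hx (le_refl (dist (x n) y))
    rw [hm, Nat.cast_le] at this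
    exact this
  have hnm' : ((n + 1 : ℕ) : ℝ) ≤ m := Nat.cast_le.2 hnm
  have hpos : (0 : ℝ) < (n + 1 : ℕ) := by positivity
  have hdiv : ((n + 1 : ℕ) : ℝ) / ((1 + ε) * a) ≤ dist (x n) y ^ 2 := by
    rw [div_le_iff₀ ha]; linarith
  have key := Real.rpow_le_rpow_of_nonpos (div_pos hpos ha) hdiv
    (by linarith : -(β / 2) ≤ 0)
  have hl : (dist (x n) y ^ 2) ^ (-(β / 2)) = pathLoss β (dist (x n) y) := by
    rw [pathLoss, ← Real.rpow_natCast, ← Real.rpow_mul dist_nonneg]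
    congr 1; push_cast; ring
  rw [hl, Real.div_rpow hpos.le ha.le, Real.rpow_neg ha.le, div_inv_eq_mul, mul_comm] at key
  exact key

theorem IsRegular.summable_and_tsum_le (h : IsRegular x y r₀ a ε)
    (hx : Monotone fun n => dist (x n) y) (ha : 0 < (1 + ε) * a) {β : ℝ} (hβ : 2 < β) {k : ℕ}
    (hk : 0 < k) (hk' : count x (Metric.closedBall y r₀) = k) :
    (Summable fun n => pathLoss β (dist (x n) y)) ∧
      ∑' i : ℕ, pathLoss β (dist (x (k + i)) y) ≤
        ((1 + ε) * a) ^ (β / 2) * ((k : ℝ) ^ (1 - β / 2) / (β / 2 - 1)) := by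
  obtain ⟨hs, hle⟩ := summable_and_tsum_rpow_neg_le (by linarith : 1 < β / 2) hk
  have hterm : ∀ i : ℕ, pathLoss β (dist (x (k + i)) y) ≤
      ((1 + ε) * a) ^ (β / 2) * ((k + i + 1 : ℕ) : ℝ) ^ (-(β / 2)) := fun i => by
    refine h.pathLoss_le hx ha (by linarith) ?_
    by_contra! hlt
    have := (dist_le_iff_lt_count hx hk' (k + i)).1 hlt.le
    omega
  have hsum : Summable fun i : ℕ => pathLoss β (dist (x (k + i)) y) :=
    Summable.of_nonneg_of_le (fun i => Real.rpow_nonneg dist_nonneg _) hterm (hs.mul_left _)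
  constructor
  · rw [← summable_nat_add_iff k]
    simpa only [add_comm _ k] using hsum
  · refine (hsum.tsum_le_tsum hterm (hs.mul_left _)).trans ?_
    rw [tsum_mul_left]
    exact mul_le_mul_of_nonneg_left hle (Real.rpow_nonneg ha.le _)

end


/-! ### Optimal decoding in regular configurations -/

/-- Bound for the interference from outside the disc of radius `r₀` in a regular configuration,
where `K` is the intensity per unit bandwidth times `π` and `ρ = K * r₀ ^ 2`. -/
noncomputable def interferenceBound (β K Q ρ ε : ℝ) : ℝ :=
  Q * (((1 + ε) * K) ^ (β / 2) * (((1 - ε) * ρ) ^ (1 - β / 2) / (β / 2 - 1)))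

/-- At `ε = 0` the bound is the mean outside interference, the term in the hypothesis of the
theorem. -/
theorem interferenceBound_zero {β K Q r₀ : ℝ} (hβ : 2 < β) (hK : 0 < K) (hr₀ : 0 < r₀) :
    interferenceBound β K Q (K * r₀ ^ 2) 0 =
      2 * (K * r₀ ^ 2) * (pathLoss β r₀ * Q) / (β - 2) := by
  have h1 : K ^ (β / 2) * K ^ (1 - β / 2) = K := by
    rw [← Real.rpow_add hK, add_sub_cancel, Real.rpow_one]
  have h2 : (r₀ ^ 2) ^ (1 - β / 2) = r₀ ^ 2 * pathLoss β r₀ := by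
    rw [pathLoss, ← Real.rpow_natCast, ← Real.rpow_mul hr₀.le, ← Real.rpow_add hr₀]
    congr 1; push_cast; ring
  have hβ' : β / 2 - 1 ≠ 0 := by linarith
  have hβ'' : β - 2 ≠ 0 := by linarith
  rw [interferenceBound, add_zero, sub_zero, one_mul, one_mul,
    Real.mul_rpow hK.le (by positivity), h2]
  calc Q * (K ^ (β / 2) * (K ^ (1 - β / 2) * (r₀ ^ 2 * pathLoss β r₀) / (β / 2 - 1)))
      = Q * ((K ^ (β / 2) * K ^ (1 - β / 2)) * (r₀ ^ 2 * pathLoss β r₀) / (β / 2 - 1)) := by ring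
    _ = _ := by
      rw [h1, show β / 2 - 1 = (β - 2) / 2 by ring]
      field_simp

theorem continuousAt_interferenceBound {β K Q ρ : ℝ} (hK : 0 < K) (hρ : 0 < ρ) :
    ContinuousAt (interferenceBound β K Q ρ) 0 := by
  unfold interferenceBound
  refine continuousAt_const.mul (ContinuousAt.mul ?_ (ContinuousAt.div_const ?_ _))
  · exact ContinuousAt.rpow_const (by fun_prop) (Or.inl (by simp [hK.ne']))
  · exact ContinuousAt.rpow_const (by fun_prop) (Or.inl (by simp [hρ.ne']))

/-- At `ε = 0` this is the rate hypothesis, and both sides are continuous there. The term `2 * ε * ρ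
* |R|` pays for a deviation of the number of decoded signals per unit bandwidth from `ρ`, for either
sign of `R`. -/
theorem exists_slack {β K Q r₀ R : ℝ} (hβ : 2 < β) (hK : 0 < K) (hQ : 0 < Q) (hr₀ : 0 < r₀)
    {ρ P₀ : ℝ} (hρ : ρ = K * r₀ ^ 2) (hP₀ : P₀ = pathLoss β r₀ * Q)
    (hR : ρ * R < C (ρ * P₀ / (1 + 2 * ρ * P₀ / (β - 2)))) :
    ∃ ε : ℝ, 0 < ε ∧ ε < 1 ∧
      ρ * R + 2 * ε * ρ * |R| < C ((1 - ε) * ρ * P₀ / (1 + interferenceBound β K Q ρ ε)) := by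
  have hρ0 : 0 < ρ := by rw [hρ]; positivity
  have hP₀0 : 0 < P₀ := by rw [hP₀]; exact mul_pos (Real.rpow_pos_of_pos hr₀ _) hQ
  have hJ0 : interferenceBound β K Q ρ 0 = 2 * ρ * P₀ / (β - 2) := by
    rw [hρ, hP₀, interferenceBound_zero hβ hK hr₀]
  have hJpos : 0 < 1 + interferenceBound β K Q ρ 0 := by
    have : 0 < 2 * ρ * P₀ / (β - 2) := div_pos (by positivity) (by linarith)
    rw [hJ0]; linarith
  have hcont : ContinuousAt
      (fun ε => C ((1 - ε) * ρ * P₀ / (1 + interferenceBound β K Q ρ ε))) 0 := by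
    refine ContinuousAt.comp (g := C) (continuousAt_C ?_) (ContinuousAt.div (by fun_prop)
      (continuousAt_const.add (continuousAt_interferenceBound hK hρ0)) hJpos.ne')
    rw [sub_zero, one_mul]
    positivity
  have hcont' : ContinuousAt (fun ε : ℝ => ρ * R + 2 * ε * ρ * |R|) 0 := by fun_prop
  have hev := hcont'.eventually_lt hcont (by simpa [hJ0] using hR)
  have hev' := (hev.filter_mono nhdsWithin_le_nhds : ∀ᶠ ε in nhdsWithin (0 : ℝ) (Set.Ioi 0), _)
  obtain ⟨ε, h1, h2⟩ := (hev'.and (Ioo_mem_nhdsGT one_pos)).exists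
  exact ⟨ε, h2.1, h2.2, h1⟩

theorem IsRegular.optCondition {x : ℕ → Plane} {y : Plane} {β K Q r₀ R B ε ρ P₀ : ℝ}
    (hβ : 2 < β) (hK : 0 < K) (hQ : 0 < Q) (hr₀ : 0 < r₀) (hB : 0 < B) (hε : 0 < ε) (hε1 : ε < 1)
    (hx : Monotone fun n => dist (x n) y) (h : IsRegular x y r₀ (K * B) ε)
    (hρ : ρ = K * r₀ ^ 2) (hP₀ : P₀ = pathLoss β r₀ * Q) (hB' : 1 ≤ ε * ρ * B)
    (hslack : ρ * R + 2 * ε * ρ * |R| <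
      C ((1 - ε) * ρ * P₀ / (1 + interferenceBound β K Q ρ ε))) :
    OptCondition (receivedPower β (Q / B) r₀ y x) (R / B) := by
  have hρ0 : 0 < ρ := by rw [hρ]; positivity
  have hP₀0 : 0 < P₀ := by rw [hP₀]; exact mul_pos (Real.rpow_pos_of_pos hr₀ _) hQ
  have hε' : 0 < 1 - ε := by linarith
  obtain ⟨k, hk, hk1⟩ := h.le_count
  have hk2 : (k : ℝ) ≤ (1 + ε) * (K * B * r₀ ^ 2) := by
    obtain ⟨m, hm, hm'⟩ := h.count_le r₀ le_rfl
    have : k = m := Nat.cast_injective (R := ℕ∞) (hk.symm.trans hm)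
    rwa [this]
  have hKB : K * B * r₀ ^ 2 = ρ * B := by rw [hρ]; ring
  rw [hKB] at hk1 hk2
  have hk0 : (0 : ℝ) < k := lt_of_lt_of_le (by positivity) hk1
  obtain ⟨hsum, hle⟩ := h.summable_and_tsum_le hx (by positivity) hβ (Nat.cast_pos.1 hk0) hk
  have hQB : 0 ≤ Q / B := by positivity
  refine optCondition_of_forall_le (k := k) (p := P₀ / B) (J := interferenceBound β K Q ρ ε)
    ?_ ?_ (by positivity) ?_ ?_ ?_
  · rw [← summable_nat_add_iff 1]
    exact hsum.mul_right (Q / B)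
  · rintro (_ | n)
    · exact mul_nonneg (Real.rpow_nonneg hr₀.le _) hQB
    · exact mul_nonneg (Real.rpow_nonneg dist_nonneg _) hQB
  · rintro (_ | n) hn
    · rw [receivedPower, hP₀, mul_div_assoc]
    · rw [receivedPower, hP₀, mul_div_assoc]
      refine mul_le_mul_of_nonneg_right ?_ hQB
      exact Real.rpow_le_rpow_of_nonpos (dist_pos.2 (h.ne n))
        ((dist_le_iff_lt_count hx hk n).2 hn) (by linarith)
  · have htail : ∑' i : ℕ, receivedPower β (Q / B) r₀ y x (k + 1 + i) =
        (∑' i : ℕ, pathLoss β (dist (x (k + i)) y)) * (Q / B) := by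
      rw [← tsum_mul_right]
      refine tsum_congr fun i => ?_
      rw [show k + 1 + i = k + i + 1 by ring, receivedPower]
    rw [htail]
    -- The exponent is negative, so the lower bound on `k` is what limits the interference; the
    -- powers of `B` then cancel.
    have hkpow : (k : ℝ) ^ (1 - β / 2) ≤ ((1 - ε) * ρ) ^ (1 - β / 2) * B ^ (1 - β / 2) := by
      rw [← Real.mul_rpow (by positivity) hB.le]
      refine Real.rpow_le_rpow_of_nonpos (by positivity) ?_ (by linarith)
      linarith
    have hBB : B ^ (β / 2) * B ^ (1 - β / 2) = B := by
      rw [← Real.rpow_add hB, add_sub_cancel, Real.rpow_one]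
    have hβ' : 0 < β / 2 - 1 := by linarith
    calc (∑' i : ℕ, pathLoss β (dist (x (k + i)) y)) * (Q / B)
        ≤ ((1 + ε) * (K * B)) ^ (β / 2) * ((k : ℝ) ^ (1 - β / 2) / (β / 2 - 1)) * (Q / B) :=
          mul_le_mul_of_nonneg_right hle hQB
      _ ≤ ((1 + ε) * (K * B)) ^ (β / 2) *
            (((1 - ε) * ρ) ^ (1 - β / 2) * B ^ (1 - β / 2) / (β / 2 - 1)) * (Q / B) := by
          gcongr
      _ = interferenceBound β K Q ρ ε * (B ^ (β / 2) * B ^ (1 - β / 2) / B) := by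
          rw [← mul_assoc, Real.mul_rpow (by positivity) hB.le, interferenceBound]
          ring
      _ = interferenceBound β K Q ρ ε := by rw [hBB, div_self hB.ne', mul_one]
  · have hJ : 0 ≤ interferenceBound β K Q ρ ε := by
      have hβ' : 0 < β / 2 - 1 := by linarith
      unfold interferenceBound
      positivity
    -- Decoded signals per unit bandwidth. The tagged one adds `1 ≤ ε * ρ * B` to the count, hence
    -- `1 + 2 * ε` in `hu2`.
    set u : ℝ := (k + 1) / B with hu
    have hu1 : (1 - ε) * ρ ≤ u := by rw [hu, le_div_iff₀ hB]; linarith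
    have hu2 : u ≤ (1 + 2 * ε) * ρ := by rw [hu, div_le_iff₀ hB]; linarith
    have habs : (u - ρ) * R ≤ 2 * ε * ρ * |R| := by
      refine (le_abs_self _).trans ?_
      rw [abs_mul]
      have hερ : 0 < ε * ρ := by positivity
      exact mul_le_mul_of_nonneg_right (abs_le.2 ⟨by linarith, by linarith⟩) (abs_nonneg R)
    calc ((k : ℝ) + 1) * (R / B) = u * R := by rw [hu]; ring
      _ ≤ ρ * R + 2 * ε * ρ * |R| := by linarith
      _ < C ((1 - ε) * ρ * P₀ / (1 + interferenceBound β K Q ρ ε)) := hslack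
      _ ≤ C (u * P₀ / (1 + interferenceBound β K Q ρ ε)) := by
        refine C_mono (by positivity) ?_
        gcongr
      _ = C (((k : ℝ) + 1) * (P₀ / B) / (1 + interferenceBound β K Q ρ ε)) := by
        rw [hu]; congr 2; ring

end WidebandNetwork

/-! ### Almost sure decoding along integer and real bandwidths -/

theorem theorem5 {Ω : Type*} [MeasurableSpace Ω] (μ : Measure Ω) [IsProbabilityMeasure μ]
    (β κ r₀ Qbar Rbar : ℝ) (hβ : 2 < β) (hκ : 0 < κ) (hr₀ : 0 < r₀) (hQ : 0 < Qbar)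
    -- the tagged receiver, and the interferers when the bandwidth is `B`
    (y : WidebandNetwork.Plane) (X : ℝ → Ω → ℕ → WidebandNetwork.Plane)
    (hX : ∀ B, 0 < B → WidebandNetwork.IsPoissonProcess μ (X B) (Real.toNNReal (κ * B)))
    -- interferers are labelled by increasing distance, that is, decreasing received power
    (hsort : ∀ B, 0 < B → ∀ ω, Monotone fun n => dist (X B ω n) y)
    (ρ P₀bar : ℝ) (hρ : ρ = κ * Real.pi * r₀ ^ 2)
    (hP₀ : P₀bar = WidebandNetwork.pathLoss β r₀ * Qbar)
    (hrate : ρ * Rbar <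
      WidebandNetwork.C (ρ * P₀bar / (1 + 2 * ρ * P₀bar / (β - 2)))) :
    -- for any joint law of the configurations, along integer bandwidths
    (∀ᵐ ω ∂μ, ∀ᶠ n : ℕ in atTop,
      WidebandNetwork.OptCondition
        (WidebandNetwork.receivedPower β (Qbar / n) r₀ y (X n ω)) (Rbar / n)) ∧
    -- for networks to which users are added as the bandwidth grows, along all real bandwidths
    ((∀ᵐ ω ∂μ, ∀ B B' : ℝ, 0 < B → B ≤ B' →
        WidebandNetwork.IsSubconfiguration (X B ω) (X B' ω)) →
      ∀ᵐ ω ∂μ, ∀ᶠ B : ℝ in atTop,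
        WidebandNetwork.OptCondition
          (WidebandNetwork.receivedPower β (Qbar / B) r₀ y (X B ω)) (Rbar / B)) := by
  open WidebandNetwork in
  have hK : 0 < κ * Real.pi := mul_pos hκ Real.pi_pos
  have hρ0 : 0 < ρ := by rw [hρ]; positivity
  obtain ⟨ε, hε, hε1, hslack⟩ := exists_slack hβ hK hQ hr₀ hρ hP₀ hrate
  have hopt : ∀ ω, ∀ B, 0 < B → 1 ≤ ε * ρ * B → IsRegular (X B ω) y r₀ (κ * Real.pi * B) ε →
      OptCondition (receivedPower β (Qbar / B) r₀ y (X B ω)) (Rbar / B) :=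
    fun ω B hB hB' h => h.optCondition hβ hK hQ hr₀ hB hε hε1 (hsort B hB ω) hρ hP₀ hB' hslack
  have hreg : ∀ δ : ℝ, 0 < δ → δ ≤ 3 → ∀ᵐ ω ∂μ, ∀ᶠ n : ℕ in atTop,
      IsRegular (X n ω) y r₀ (κ * Real.pi * n) δ := by
    intro δ hδ hδ3
    have h := ae_eventually_isRegular (X := fun n : ℕ => X n) hκ
      (fun n => Real.coe_toNNReal (κ * n) (by positivity))
      (fun n hn => hX n (Nat.cast_pos.2 hn)) y hr₀ (by linarith : 0 < δ / 3) (by linarith)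
    simpa only [mul_div_cancel₀ δ (three_ne_zero' ℝ), mul_right_comm κ _ Real.pi] using h
  -- The bound `4 ≤ ε * B` lets the passage from `ε / 2` to `ε` absorb the rounding of `B` to `⌊B⌋₊`
  -- and `⌊B⌋₊ + 1`.
  have hlarge : ∀ᶠ B : ℝ in atTop, 0 < B ∧ 1 ≤ ε * ρ * B ∧ 4 ≤ ε * B :=
    (eventually_gt_atTop 0).and
      (((tendsto_id.const_mul_atTop (mul_pos hε hρ0)).eventually_ge_atTop 1).and
        ((tendsto_id.const_mul_atTop hε).eventually_ge_atTop 4))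
  constructor
  · filter_upwards [hreg ε hε (by linarith)] with ω hω
    filter_upwards [hω, tendsto_natCast_atTop_atTop.eventually hlarge] with n hn hn'
    exact hopt ω n hn'.1 hn'.2.1 hn
  · intro hsub
    filter_upwards [hsub, hreg (ε / 2) (by linarith) (by linarith)] with ω hω hω'
    have hfloor := (tendsto_nat_floor_atTop (α := ℝ)).eventually
      (hω'.and (((tendsto_add_atTop_nat 1).eventually hω').and (eventually_gt_atTop 0)))
    filter_upwards [hlarge, hfloor] with B hB hn
    obtain ⟨hB0, hB1, hB4⟩ := hB
    obtain ⟨h1, h2, hpos⟩ := hn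
    have hle : (⌊B⌋₊ : ℝ) ≤ B := Nat.floor_le hB0.le
    have hlt : B < (⌊B⌋₊ : ℝ) + 1 := Nat.lt_floor_add_one B
    refine hopt ω B hB0 hB1 (h1.of_between h2 (hω _ _ (Nat.cast_pos.2 hpos) hle)
      (hω _ _ hB0 (by push_cast; exact hlt.le)) ?_ ?_)
    · rw [mul_left_comm, mul_left_comm (1 - ε / 2)]
      refine mul_le_mul_of_nonneg_left ?_ hK.le
      nlinarith
    · push_cast
      rw [mul_left_comm, mul_left_comm (1 + ε)]
      refine mul_le_mul_of_nonneg_left ?_ hK.le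
      nlinarith
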